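/- Let $\Gamma$ be a countable (discrete) group. A total order on $\Gamma$ is a binary relation $\prec$ on $\Gamma$ that is irreflexive, antisymmetric ($x\prec y$ implies $y\not\prec x$), transitive, and such that $x\prec y$ or $y\prec x$ whenever $x\neq y$. Let $\operatorname{Ord}(\Gamma)\subset\{0,1\}^{\Gamma\times\Gamma}$ be the space of total orders on $\Gamma$ with the subspace topology of the product topology, on which $\Gamma$ acts by $$x\,[\gamma\cdot{\prec}]\,y \iff \gamma^{-1}x\prec\gamma^{-1}y .$$ An invariant random order (IRO) on $\Gamma$ is a $\Gamma$-invariant Borel probability measure on $\operatorname{Ord}(\Gamma)$. Let $\Gamma\curvearrowright(X,\mathcal B,\mu)$ be an ergodic measure-preserving action by measurable maps on a standard Borel probability space which is essentially free, i.e. the stabilizer of $\mu$-almost every $x\in X$ is trivial. Then the action can be realized as an IRO: there is an IRO $\nu$ on $\Gamma$ such that $\Gamma\curvearrowright(X,\mu)$ and $\Gamma\curvearrowright(\operatorname{Ord}(\Gamma),\nu)$ are measurably isomorphic. That is, there are $\Gamma$-invariant measurable sets $X_0\subset X$ and $Y_0\subset\operatorname{Ord}(\Gamma)$ of full measure and a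 $\Gamma$-equivariant bijection $X_0\to Y_0$, measurable in both directions, which carries $\mu|_{X_0}$ to $\nu|_{Y_0}$. -/

import Mathlib

open MeasureTheory

/-- The set of total (strict) orders on `Γ`, as a subset of the set `{0,1}^(Γ × Γ)` of all binary
relations: `r (x, y) = true` means `x ≺ y`. -/
def TotalOrd (Γ : Type*) : Type _ :=
  {r : Γ × Γ → Bool //
    (∀ x y, r (x, y) = true → ¬ r (y, x) = true) ∧
    (∀ x, ¬ r (x, x) = true) ∧
    (∀ x y z, r (x, y) = true → r (y, z) = true → r (x, z) = true) ∧
    (∀ x y, x ≠ y → r (x, y) = true ∨ r (y, x) = true)}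

namespace TotalOrd

/-- The subspace topology of the product topology on `{0,1}^(Γ × Γ)` (`{0,1}` is discrete). -/
instance instTopologicalSpace (Γ : Type*) : TopologicalSpace (TotalOrd Γ) :=
  TopologicalSpace.induced Subtype.val inferInstance

/-- The Borel `σ`-algebra of the space of total orders. -/
instance instMeasurableSpace (Γ : Type*) : MeasurableSpace (TotalOrd Γ) := borel (TotalOrd Γ)

instance instBorelSpace (Γ : Type*) : BorelSpace (TotalOrd Γ) := ⟨rfl⟩

/-- The left action of `Γ` on total orders:
`x [γ • ≺] y` if and only if `γ⁻¹ x ≺ γ⁻¹ y`. -/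
instance instMulAction (Γ : Type*) [Group Γ] : MulAction Γ (TotalOrd Γ) where
  smul γ r := ⟨fun p => r.1 (γ⁻¹ * p.1, γ⁻¹ * p.2),
    fun _ _ h => r.2.1 _ _ h,
    fun _ => r.2.2.1 _,
    fun _ _ _ h₁ h₂ => r.2.2.2.1 _ _ _ h₁ h₂,
    fun _ _ h => r.2.2.2.2 _ _ (fun h' => h (mul_left_cancel h'))⟩
  one_smul r := Subtype.ext (funext fun p => by
    change r.1 ((1 : Γ)⁻¹ * p.1, (1 : Γ)⁻¹ * p.2) = r.1 p
    simp)
  mul_smul a b r := Subtype.ext (funext fun p => by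
    change r.1 ((a * b)⁻¹ * p.1, (a * b)⁻¹ * p.2) = r.1 (b⁻¹ * (a⁻¹ * p.1), b⁻¹ * (a⁻¹ * p.2))
    simp [mul_assoc])

end TotalOrd

/-- An invariant random order on `Γ`: a `Γ`-invariant Borel probability measure on the space of
total orders on `Γ`. -/
structure IsInvariantRandomOrder (Γ : Type*) [Group Γ] (ν : Measure (TotalOrd Γ)) : Prop where
  isProbabilityMeasure : IsProbabilityMeasure ν
  smulInvariantMeasure : SMulInvariantMeasure Γ (TotalOrd Γ) ν

/-- The action of `Γ` on `(X, μ)` is essentially free: almost every point has trivial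
stabilizer. -/
def IsEssentiallyFree (Γ : Type*) {X : Type*} [Group Γ] [MulAction Γ X] [MeasurableSpace X]
    (μ : Measure X) : Prop :=
  ∀ᵐ x ∂μ, MulAction.stabilizer Γ x = ⊥

/-- Isomorphism of measure-preserving `Γ`-actions on `(X, μ)` and `(Y, ν)`: after discarding
invariant measurable null sets there is an equivariant, measure-preserving, bimeasurable
bijection. -/
def MeasurablyIsomorphic (Γ : Type*) {X Y : Type*} [Group Γ] [MulAction Γ X] [MulAction Γ Y]
    [MeasurableSpace X] [MeasurableSpace Y] (μ : Measure X) (ν : Measure Y) : Prop :=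
  ∃ (X₀ : Set X) (Y₀ : Set Y) (e : X₀ ≃ᵐ Y₀),
    MeasurableSet X₀ ∧ MeasurableSet Y₀ ∧
    μ X₀ᶜ = 0 ∧ ν Y₀ᶜ = 0 ∧
    (∀ g : Γ, ∀ x ∈ X₀, g • x ∈ X₀) ∧
    (∀ g : Γ, ∀ y ∈ Y₀, g • y ∈ Y₀) ∧
    (∀ (g : Γ) (x : X₀) (hgx : g • (x : X) ∈ X₀), (e ⟨g • (x : X), hgx⟩ : Y) = g • (e x : Y)) ∧
    MeasurePreserving e (μ.comap Subtype.val) (ν.comap Subtype.val)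

/-! Embed `X` into the line by a Borel injection `φ` and send `x` to the order on `Γ` that compares
the values `φ (a⁻¹ • x)`. Freeness makes this map equivariant almost everywhere, so the image of `μ`
is an IRO; what remains is that the order determines `x` on a conull set
(`exists_conull_injOn_ofOrbit`). The order records which `g` satisfy `φ (g • x) < φ x`. By
ergodicity the frequency of such `g` should be the mass below `φ x`, and the distribution function
is strictly increasing on a conull set. Since `Γ` need not be amenable, frequencies are taken along
the weights of the mean ergodic theorem (`exists_weights_tendsto_measureReal`). These work for a
fixed level only, while `φ x` varies; `exists_countable_levels_separating` reduces to countably many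
levels. -/

open Filter Set
open scoped Topology RealInnerProductSpace

/-! ### Mean ergodic theorem without amenability -/

/-- A closed convex set in a real Hilbert space contains a vector which is fixed by every
norm-preserving map that leaves the convex set invariant (the vector of minimal norm). -/
theorem exists_mem_fixed_of_isClosed_convex {H : Type*} [NormedAddCommGroup H]
    [InnerProductSpace ℝ H] [CompleteSpace H] {K : Set H} (hne : K.Nonempty) (hK : IsClosed K)
    (hconv : Convex ℝ K) :
    ∃ v ∈ K, ∀ T : H → H, (∀ u, ‖T u‖ = ‖u‖) → MapsTo T K K → T v = v := by
  obtain ⟨v, hv, hmin⟩ := exists_norm_eq_iInf_of_complete_convex hne hK.isComplete hconv 0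
  refine ⟨v, hv, fun T hT hTK => ?_⟩
  -- Minimality gives `‖v‖² ≤ ⟪v, T v⟫`; with `‖T v‖ = ‖v‖` this forces `‖T v - v‖² ≤ 0`.
  have h := (norm_eq_iInf_iff_real_inner_le_zero hconv hv).1 hmin (T v) (hTK hv)
  rw [zero_sub, inner_neg_left, inner_sub_right, real_inner_self_eq_norm_sq] at h
  have h2 := norm_sub_sq_real (T v) v
  rw [hT, real_inner_comm] at h2
  have : ‖T v - v‖ = 0 := by
    have := sq_nonneg ‖T v - v‖
    exact pow_eq_zero_iff two_ne_zero |>.1 (by linarith)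
  exact sub_eq_zero.1 (norm_eq_zero.1 this)

/-- A function which is almost everywhere invariant under an ergodic action is almost everywhere
constant. -/
theorem ErgodicSMul.ae_eq_const_of_ae_eq_comp_smul {Γ X E : Type*} [SMul Γ X] [MeasurableSpace X]
    {μ : Measure X} [ErgodicSMul Γ X μ] [MeasurableSpace E] [Nonempty E]
    [MeasurableSpace.CountablySeparated E] {f : X → E} (hf : NullMeasurable f μ)
    (h : ∀ g : Γ, (fun x => f (g • x)) =ᵐ[μ] f) : ∃ c, f =ᵐ[μ] Function.const X c := by
  refine exists_eventuallyEq_const_of_forall_separating MeasurableSet fun U hU => ?_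
  refine Filter.eventuallyConst_set.1 (MeasureTheory.aeconst_of_forall_preimage_smul_ae_eq Γ
    (hf hU) fun g => ?_)
  filter_upwards [h g] with x hx
  exact congrArg U hx

/-- Von Neumann's mean ergodic theorem for an ergodic action of an arbitrary group: the mean of a
square integrable function is an almost everywhere limit of convex combinations of translates. -/
theorem exists_weights_tendsto_integral (Γ : Type*) {X E : Type*} [Group Γ] [MulAction Γ X]
    [MeasurableSpace X] [MeasurableConstSMul Γ X] {μ : Measure X} [IsProbabilityMeasure μ]
    [ErgodicSMul Γ X μ] [NormedAddCommGroup E] [InnerProductSpace ℝ E] [CompleteSpace E]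
    [SecondCountableTopology E] {f : X → E} (hf : MemLp f 2 μ) :
    ∃ w : ℕ → Γ →₀ ℝ, (∀ n g, 0 ≤ w n g) ∧
      ∀ᵐ x ∂μ, Tendsto (fun n => Finsupp.linearCombination ℝ (fun g : Γ => f (g • x)) (w n))
        atTop (𝓝 (∫ x, f x ∂μ)) := by
  borelize E
  let F : Γ → Lp E 2 μ := fun g => DomMulAct.mk g • hf.toLp f
  let C : Set (Lp E 2 μ) := convexHull ℝ (range F)
  have hFmem : ∀ g, F g ∈ closure C := fun g => subset_closure (subset_convexHull ℝ _ ⟨g, rfl⟩)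
  have hFae : ∀ g, F g =ᵐ[μ] fun x => f (g • x) := fun g => by
    refine (DomMulAct.smul_Lp_ae_eq (DomMulAct.mk g) (hf.toLp f)).trans ?_
    exact (measurePreserving_smul g μ).quasiMeasurePreserving.ae_eq_comp hf.coeFn_toLp
  obtain ⟨v, hv, hfix⟩ := exists_mem_fixed_of_isClosed_convex (K := closure C) ⟨_, hFmem 1⟩
    isClosed_closure (convex_convexHull ℝ _).closure
  have hvinv : ∀ g : Γ, DomMulAct.mk g • v = v := fun g => by
    refine hfix (fun u => DomMulAct.mk g • u) (fun u => DomMulAct.norm_smul_Lp _ _) ?_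
    refine MapsTo.closure ?_ ((isometry_smul (Lp E 2 μ) (DomMulAct.mk g)).continuous)
    let T : Lp E 2 μ →ₗ[ℝ] Lp E 2 μ :=
      { toFun := fun u => DomMulAct.mk g • u
        map_add' := fun a b => smul_add _ a b
        map_smul' := fun a b => smul_comm _ a b }
    change MapsTo T C C
    rw [mapsTo_iff_image_subset, T.image_convexHull]
    refine convexHull_mono ?_
    rintro _ ⟨_, ⟨k, rfl⟩, rfl⟩
    refine ⟨k * g, ?_⟩
    change F (k * g) = DomMulAct.mk g • F k
    rw [smul_smul, ← DomMulAct.mk_mul]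
  obtain ⟨c, hc⟩ := ErgodicSMul.ae_eq_const_of_ae_eq_comp_smul (Γ := Γ) (f := v)
    (Lp.aestronglyMeasurable v).aemeasurable.nullMeasurable fun g => by
      have := DomMulAct.smul_Lp_ae_eq (DomMulAct.mk g) v
      rw [hvinv] at this
      exact this.symm
  have hint : c = ∫ x, f x ∂μ := by
    -- Pairing with a constant function is continuous and linear, and takes the same value on all
    -- translates of `f`, hence on their closed convex hull.
    have key : ∀ u ∈ closure C, ∫ x, u x ∂μ = ∫ x, f x ∂μ := by
      intro u hu
      refine ext_inner_left ℝ fun a => ?_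
      have hind : ∀ u : Lp E 2 μ, inner ℝ a (∫ x, u x ∂μ) =
          inner ℝ (indicatorConstLp 2 MeasurableSet.univ (measure_ne_top μ _) a) u := fun u => by
        rw [L2.inner_indicatorConstLp_eq_inner_setIntegral, setIntegral_univ]
      rw [hind]
      let φ := innerSL ℝ (indicatorConstLp 2 MeasurableSet.univ (measure_ne_top μ _) a)
      have hcl : IsClosed {u : Lp E 2 μ | φ u = inner ℝ a (∫ x, f x ∂μ)} :=
        isClosed_eq φ.continuous continuous_const
      refine closure_minimal (convexHull_min ?_ ?_) hcl hu
      · rintro _ ⟨g, rfl⟩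
        change φ (F g) = _
        rw [innerSL_apply_apply]
        rw [← hind, integral_congr_ae (hFae g), integral_smul_eq_self]
      · exact (convex_singleton _).linear_preimage φ.toLinearMap
    have := key v hv
    rw [integral_congr_ae hc] at this
    simpa using this
  subst hint
  obtain ⟨u, huC, hu⟩ := mem_closure_iff_seq_limit.1 hv
  obtain ⟨ns, -, hns⟩ := (tendstoInMeasure_of_tendsto_Lp hu).exists_seq_tendsto_ae
  have hw : ∀ n, ∃ w : Γ →₀ ℝ, (∀ g, 0 ≤ w g) ∧
      u n =ᵐ[μ] fun x => Finsupp.linearCombination ℝ (fun g : Γ => f (g • x)) w := by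
    intro n
    obtain ⟨ι, _, w, z, hw0, -, hz, hsum⟩ := mem_convexHull_iff_exists_fintype.1 (huC n)
    choose k hk using hz
    refine ⟨∑ i, Finsupp.single (k i) (w i), fun g => ?_, ?_⟩
    · rw [Finsupp.finsetSum_apply]
      exact Finset.sum_nonneg fun i _ => Finsupp.single_nonneg.2 (hw0 i) g
    · rw [← hsum]
      have h1 := Lp.coeFn_fun_finsetSum (μ := μ) (p := 2) Finset.univ (fun i => w i • z i)
      have h2 : ∀ᵐ x ∂μ, ∀ i, (w i • z i : Lp E 2 μ) x = w i • f (k i • x) := by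
        refine ae_all_iff.2 fun i => ?_
        filter_upwards [Lp.coeFn_smul (w i) (z i), hFae (k i)] with x hx hx'
        rw [hx, Pi.smul_apply, ← hk, hx']
      filter_upwards [h1, h2] with x hx hx'
      rw [hx, map_sum]
      exact Finset.sum_congr rfl fun i _ => by rw [hx', Finsupp.linearCombination_single]
  choose w hw0 hw using hw
  refine ⟨fun n => w (ns n), fun n => hw0 _, ?_⟩
  filter_upwards [hns, hc, ae_all_iff.2 hw] with x hx hcx hwx
  rw [hcx, Function.const_apply] at hx
  simpa only [hwx] using hx

/-- The measures of two sets are almost everywhere limits of the frequencies of visits, with the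
same weights for both sets. -/
theorem exists_weights_tendsto_measureReal (Γ : Type*) {X : Type*} [Group Γ] [MulAction Γ X]
    [MeasurableSpace X] [MeasurableConstSMul Γ X] {μ : Measure X} [IsProbabilityMeasure μ]
    [ErgodicSMul Γ X μ] {A B : Set X} (hA : MeasurableSet A) (hB : MeasurableSet B) :
    ∃ w : ℕ → Γ →₀ ℝ, (∀ n g, 0 ≤ w n g) ∧ ∀ᵐ x ∂μ,
      Tendsto (fun n => (w n).sum fun g c => c * A.indicator 1 (g • x)) atTop (𝓝 (μ.real A)) ∧
      Tendsto (fun n => (w n).sum fun g c => c * B.indicator 1 (g • x)) atTop (𝓝 (μ.real B)) := by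
  -- Packing both indicators into one complex function yields common weights.
  let f : X → ℂ := fun x => ⟨A.indicator 1 x, B.indicator 1 x⟩
  have hmA : MemLp (A.indicator (1 : X → ℝ)) 2 μ := (memLp_const 1).indicator hA
  have hmB : MemLp (B.indicator (1 : X → ℝ)) 2 μ := (memLp_const 1).indicator hB
  have hf : MemLp f 2 μ := memLp_re_im_iff.1 ⟨hmA, hmB⟩
  have hfi : Integrable f μ := hf.integrable one_le_two
  obtain ⟨w, hw0, hw⟩ := exists_weights_tendsto_integral Γ hf
  refine ⟨w, hw0, ?_⟩
  filter_upwards [hw] with x hx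
  have hre : (∫ x, f x ∂μ).re = μ.real A := by
    rw [← integral_indicator_one hA]
    exact (integral_re hfi).symm
  have him : (∫ x, f x ∂μ).im = μ.real B := by
    rw [← integral_indicator_one hB]
    exact (integral_im hfi).symm
  rw [← hre, ← him]
  constructor
  · refine ((Complex.continuous_re.tendsto _).comp hx).congr fun n => ?_
    simp [Finsupp.linearCombination_apply, Finsupp.sum, f]
  · refine ((Complex.continuous_im.tendsto _).comp hx).congr fun n => ?_
    simp [Finsupp.linearCombination_apply, Finsupp.sum, f]
-- Distribution functions on the line
/-- For a measure on the line, almost every point has mass immediately to its right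
(the point itself included). -/
theorem ae_forall_gt_measure_Ico_pos (ν : Measure ℝ) :
    ∀ᵐ s ∂ν, ∀ t > s, 0 < ν (Ico s t) := by
  have hq : ∀ q : ℚ, ∀ᵐ s ∂ν, s < (q : ℝ) → 0 < ν (Ico s (q : ℝ)) := by
    intro q
    have : ν {s : ℝ | s < (q : ℝ) ∧ ν (Ico s (q : ℝ)) = 0} = 0 := by
      -- If the bad set has a least element `t`, it lies in the null set `Ico t q`. Otherwise each
      -- bad point has a smaller bad point `t`, and `Ico t q` is a null neighbourhood of it.
      by_cases hmin : ∃ t, (t < (q : ℝ) ∧ ν (Ico t q) = 0) ∧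
          ∀ s, s < (q : ℝ) ∧ ν (Ico s q) = 0 → t ≤ s
      · obtain ⟨t, ht, hmin⟩ := hmin
        exact measure_mono_null (t := Ico t (q : ℝ)) (fun s hs => ⟨hmin s hs, hs.1⟩) ht.2
      · push Not at hmin
        refine measure_null_of_locally_null _ fun s hs => ?_
        obtain ⟨t, ht, hts⟩ := hmin s hs
        exact ⟨Ico t q, mem_nhdsWithin_of_mem_nhds (Ico_mem_nhds hts hs.1), ht.2⟩
    filter_upwards [measure_eq_zero_iff_ae_notMem.1 this] with s hs hsq
    exact pos_iff_ne_zero.2 fun h => hs ⟨hsq, h⟩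
  filter_upwards [ae_all_iff.2 hq] with s hs t hst
  obtain ⟨q, hsq, hqt⟩ := exists_rat_btwn hst
  exact (hs q hsq).trans_le (measure_mono (Ico_subset_Ico_right hqt.le))

/-- Countably many levels suffice to separate almost every point from all larger ones by the
distribution function of a finite measure. -/
theorem exists_countable_levels_separating (ν : Measure ℝ) [IsFiniteMeasure ν] :
    ∃ D : Set ℝ, D.Countable ∧ ∀ᵐ s ∂ν, ∀ t > s, ∃ r ∈ D, ∃ q ∈ D,
      s ≤ r ∧ q ≤ t ∧ ν.real (Iio r) < ν.real (Iio q) := by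
  refine ⟨range ((↑) : ℚ → ℝ) ∪ {a | 0 < ν {s | s = a}}, (countable_range _).union
    (Measure.countable_meas_level_set_pos measurable_id), ?_⟩
  have hlt : ∀ r q : ℝ, 0 < ν (Ico r q) → ν.real (Iio r) < ν.real (Iio q) := by
    intro r q h
    have hrq : r < q := by
      by_contra hrq
      simp [Ico_eq_empty hrq] at h
    rw [← Iio_union_Ico_eq_Iio hrq.le, measureReal_union
      ((Iio_disjoint_Ici le_rfl).mono_right Ico_subset_Ici_self) measurableSet_Ico]
    exact lt_add_of_pos_right _ (ENNReal.toReal_pos h.ne' (measure_ne_top _ _))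
  filter_upwards [ae_forall_gt_measure_Ico_pos ν] with s hs t hst
  obtain ⟨q, hsq, hqt⟩ := exists_rat_btwn hst
  -- If no rational `r > s` works, all mass of `Ico s q` sits at `s`, so `s` is an atom and itself a
  -- level in `D`.
  by_cases h : ∃ r : ℚ, s < r ∧ 0 < ν (Ico (r : ℝ) q)
  · obtain ⟨r, hsr, hr⟩ := h
    exact ⟨r, .inl ⟨r, rfl⟩, q, .inl ⟨q, rfl⟩, hsr.le, hqt.le, hlt _ _ hr⟩
  · push Not at h
    refine ⟨s, .inr ?_, q, .inl ⟨q, rfl⟩, le_rfl, hqt.le, hlt _ _ (hs q hsq)⟩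
    have hnull : ν (⋃ r : {r : ℚ // s < r}, Ico (r.1 : ℝ) q) = 0 :=
      measure_iUnion_null fun r => nonpos_iff_eq_zero.1 (h r.1 r.2)
    have hsub : Ico s (q : ℝ) ⊆ {s' | s' = s} ∪ ⋃ r : {r : ℚ // s < r}, Ico (r.1 : ℝ) q := by
      intro y hy
      rcases hy.1.eq_or_lt with rfl | hlt
      · exact .inl rfl
      · obtain ⟨r, hr, hry⟩ := exists_rat_btwn hlt
        exact .inr (mem_iUnion.2 ⟨⟨r, hr⟩, hry.le, hy.2⟩)
    have := (hs q hsq).trans_le ((measure_mono hsub).trans (measure_union_le _ _))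
    rwa [hnull, add_zero] at this

/-! ### Orbit orders and recovery of the point -/

namespace TotalOrd

/-- The order on `Γ` obtained by comparing the values of `φ` along the orbit of `x`; ties are
broken by the injection `e`. -/
noncomputable def ofOrbit {Γ X : Type*} [Group Γ] [MulAction Γ X] (φ : X → ℝ) (e : Γ ↪ ℕ) (x : X) :
    TotalOrd Γ := by
  classical
  exact ⟨fun p => decide (toLex (φ (p.1⁻¹ • x), e p.1) < toLex (φ (p.2⁻¹ • x), e p.2)),
    fun a b h h' => lt_asymm (of_decide_eq_true h) (of_decide_eq_true h'),
    fun a h => lt_irrefl _ (of_decide_eq_true h),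
    fun a b c h h' => decide_eq_true ((of_decide_eq_true h).trans (of_decide_eq_true h')),
    fun a b hab => (lt_or_gt_of_ne fun h => hab (e.injective (Prod.ext_iff.1
      (toLex.injective h)).2)).imp decide_eq_true decide_eq_true⟩

section

variable {Γ X : Type*} [Group Γ] [MulAction Γ X] {φ : X → ℝ} {e : Γ ↪ ℕ}

theorem ofOrbit_apply_iff {x : X} {a b : Γ} : (ofOrbit φ e x).1 (a, b) = true ↔
    φ (a⁻¹ • x) < φ (b⁻¹ • x) ∨ φ (a⁻¹ • x) = φ (b⁻¹ • x) ∧ e a < e b := by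
  simp only [ofOrbit, decide_eq_true_eq, Prod.Lex.toLex_lt_toLex]

/-- A tie would give `b * a⁻¹` in the stabilizer, so `a = b`. The tie-break `e`, which is not
equivariant, thus plays no role at free points. -/
theorem ofOrbit_apply_iff_of_stabilizer_eq_bot (hφ : Function.Injective φ) {x : X}
    (hx : MulAction.stabilizer Γ x = ⊥) {a b : Γ} : (ofOrbit φ e x).1 (a, b) = true ↔
    φ (a⁻¹ • x) < φ (b⁻¹ • x) := by
  rw [ofOrbit_apply_iff, or_iff_left]
  rintro ⟨h, hab⟩
  have hmem : b * a⁻¹ ∈ MulAction.stabilizer Γ x := by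
    rw [MulAction.mem_stabilizer_iff, mul_smul, hφ h, smul_inv_smul]
  rw [hx, Subgroup.mem_bot, mul_inv_eq_one] at hmem
  exact hab.ne (by rw [hmem])

theorem ofOrbit_smul (hφ : Function.Injective φ) {x : X}
    (hx : MulAction.stabilizer Γ x = ⊥) (g : Γ) : ofOrbit φ e (g • x) = g • ofOrbit φ e x := by
  have hgx : MulAction.stabilizer Γ (g • x) = ⊥ := by
    rw [MulAction.stabilizer_smul_eq_stabilizer_map_conj, hx, Subgroup.map_bot]
  refine Subtype.ext (funext fun ⟨a, b⟩ => Bool.eq_iff_iff.2 ?_)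
  change _ ↔ (ofOrbit φ e x).1 (g⁻¹ * a, g⁻¹ * b) = true
  rw [ofOrbit_apply_iff_of_stabilizer_eq_bot hφ hgx, ofOrbit_apply_iff_of_stabilizer_eq_bot hφ hx]
  simp only [mul_inv_rev, inv_inv, mul_smul]

end

theorem isEmbedding_val (Γ : Type*) :
    Topology.IsEmbedding (Subtype.val : TotalOrd Γ → Γ × Γ → Bool) :=
  ⟨⟨rfl⟩, Subtype.val_injective⟩

instance instT2Space (Γ : Type*) : T2Space (TotalOrd Γ) :=
  (isEmbedding_val Γ).t2Space

instance instSecondCountableTopology (Γ : Type*) [Countable Γ] :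
    SecondCountableTopology (TotalOrd Γ) :=
  (isEmbedding_val Γ).secondCountableTopology

theorem measurable_iff {Γ X : Type*} [Countable Γ] [MeasurableSpace X] {f : X → TotalOrd Γ} :
    Measurable f ↔ ∀ p, MeasurableSet {x | (f x).1 p = true} := by
  have h : Measurable f ↔ Measurable fun x => (f x).1 := by
    have hcomap : instMeasurableSpace Γ = MeasurableSpace.comap Subtype.val inferInstance := by
      rw [BorelSpace.measurable_eq (α := Γ × Γ → Bool), ← borel_comap]
      rfl
    rw [hcomap]
    exact measurable_comap_iff
  rw [h, measurable_pi_iff]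
  refine forall_congr' fun p => ⟨fun h => h (measurableSet_singleton true), fun h => ?_⟩
  exact measurable_to_bool h

instance instContinuousConstSMul (Γ : Type*) [Group Γ] : ContinuousConstSMul Γ (TotalOrd Γ) where
  continuous_const_smul g := by
    refine (isEmbedding_val Γ).continuous_iff.2 (continuous_pi fun p => ?_)
    exact (continuous_apply (g⁻¹ * p.1, g⁻¹ * p.2)).comp (isEmbedding_val Γ).continuous

theorem measurable_ofOrbit {Γ X : Type*} [Group Γ] [Countable Γ] [MulAction Γ X]
    [MeasurableSpace X] [MeasurableConstSMul Γ X] {φ : X → ℝ} (hφ : Measurable φ) (e : Γ ↪ ℕ) :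
    Measurable (ofOrbit φ e : X → TotalOrd Γ) := by
  refine measurable_iff.2 fun ⟨a, b⟩ => ?_
  have h : ∀ c : Γ, Measurable fun x : X => φ (c • x) := fun c => hφ.comp (measurable_const_smul c)
  simp only [ofOrbit_apply_iff]
  exact (measurableSet_lt (h _) (h _)).union
    ((measurableSet_eq_fun (h _) (h _)).inter (MeasurableSet.const _))

/-- For an ergodic action, almost every point with trivial stabilizer can be recovered from its
orbit order. -/
theorem exists_conull_injOn_ofOrbit {Γ X : Type*} [Group Γ] [MulAction Γ X]
    [MeasurableSpace X] [MeasurableConstSMul Γ X] {μ : Measure X} [IsProbabilityMeasure μ]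
    [ErgodicSMul Γ X μ] (hfree : IsEssentiallyFree Γ μ) {φ : X → ℝ} (hφ : Measurable φ)
    (hinj : Function.Injective φ) (e : Γ ↪ ℕ) :
    ∃ s : Set X, μ sᶜ = 0 ∧ InjOn (ofOrbit φ e : X → TotalOrd Γ) s := by
  obtain ⟨D, hDc, hD⟩ := exists_countable_levels_separating (μ.map φ)
  have hD := ae_of_ae_map hφ.aemeasurable hD
  have hreal : ∀ r, (μ.map φ).real (Iio r) = μ.real (φ ⁻¹' Iio r) := fun r =>
    map_measureReal_apply hφ measurableSet_Iio
  simp only [hreal] at hD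
  choose w hw0 hw using fun p : ℝ × ℝ => exists_weights_tendsto_measureReal Γ (μ := μ)
    (hφ (measurableSet_Iio (a := p.1))) (hφ (measurableSet_Iio (a := p.2)))
  have hwD := (ae_ball_iff (hDc.prod hDc)).2 fun p _ => hw p
  refine ⟨_, (hD.and (hwD.and hfree)), ?_⟩
  have key : ∀ x y : X, MulAction.stabilizer Γ x = ⊥ →
      (∀ t > φ x, ∃ r ∈ D, ∃ q ∈ D,
        φ x ≤ r ∧ q ≤ t ∧ μ.real (φ ⁻¹' Iio r) < μ.real (φ ⁻¹' Iio q)) →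
      (∀ p ∈ D ×ˢ D, Tendsto (fun n => (w p n).sum fun g c =>
        c * (φ ⁻¹' Iio p.1).indicator 1 (g • x)) atTop (𝓝 (μ.real (φ ⁻¹' Iio p.1)))) →
      (∀ p ∈ D ×ˢ D, Tendsto (fun n => (w p n).sum fun g c =>
        c * (φ ⁻¹' Iio p.2).indicator 1 (g • y)) atTop (𝓝 (μ.real (φ ⁻¹' Iio p.2)))) →
      ofOrbit φ e x = (ofOrbit φ e y : TotalOrd Γ) → ¬ φ x < φ y := by
    -- Take levels with `φ x ≤ r` and `q ≤ φ y`. If `φ (g • y) < q`, then `g⁻¹` precedes `1` in the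
    -- common order, so `φ (g • x) < r`. As the weights are nonnegative and shared, the limits give
    -- mass below `q` at most mass below `r`, a contradiction.
    intro x y hx hsep hlx hly hxy hlt
    obtain ⟨r, hr, q, hq, hxr, hqy, hrq⟩ := hsep _ hlt
    refine hrq.not_ge (le_of_tendsto_of_tendsto' (hly (r, q) ⟨hr, hq⟩) (hlx (r, q) ⟨hr, hq⟩)
      fun n => Finset.sum_le_sum fun g _ => mul_le_mul_of_nonneg_left ?_ (hw0 _ n g))
    by_cases hgy : φ (g • y) < q
    · have h1 : (ofOrbit φ e y).1 (g⁻¹, 1) = true := by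
        rw [ofOrbit_apply_iff, inv_inv, inv_one, one_smul]
        exact .inl (hgy.trans_le hqy)
      rw [← hxy, ofOrbit_apply_iff_of_stabilizer_eq_bot hinj hx, inv_inv, inv_one, one_smul] at h1
      have hgx : φ (g • x) < r := h1.trans_le hxr
      simp [hgx, hgy]
    · rw [indicator_of_notMem (show g • y ∉ φ ⁻¹' Iio (r, q).2 from hgy)]
      exact indicator_nonneg (fun _ _ => zero_le_one) _
  rintro x ⟨hsx, hlx, hfx⟩ y ⟨hsy, hly, hfy⟩ hxy
  refine hinj (le_antisymm (not_lt.1 ?_) (not_lt.1 ?_))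
  · exact key y x hfy hsy (fun p hp => (hly p hp).1) (fun p hp => (hlx p hp).2) hxy.symm
  · exact key x y hfx hsx (fun p hp => (hlx p hp).1) (fun p hp => (hly p hp).2) hxy

end TotalOrd

/-! ### Passing to the image measure -/

/-- A conull set contains a measurable conull set which is invariant under a given measure
preserving action of a countable group. -/
theorem exists_measurableSet_invariant_subset_of_conull (Γ : Type*) {X : Type*} [Group Γ]
    [Countable Γ] [MulAction Γ X] [MeasurableSpace X] [MeasurableConstSMul Γ X] {μ : Measure X}
    [SMulInvariantMeasure Γ X μ] {s : Set X} (hs : μ sᶜ = 0) :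
    ∃ t ⊆ s, MeasurableSet t ∧ μ tᶜ = 0 ∧ ∀ g : Γ, ∀ x ∈ t, g • x ∈ t := by
  let u : Set X := (toMeasurable μ sᶜ)ᶜ
  have hus : u ⊆ s := compl_subset_comm.1 (subset_toMeasurable μ sᶜ)
  have hu : MeasurableSet u := (measurableSet_toMeasurable μ sᶜ).compl
  refine ⟨⋂ g : Γ, (g • ·) ⁻¹' u, fun x hx => hus ?_,
    .iInter fun g => measurable_const_smul g hu, ?_, fun g x hx => ?_⟩
  · simpa using mem_iInter.1 hx 1
  · rw [compl_iInter]
    refine measure_iUnion_null fun g => ?_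
    rw [← preimage_compl, measure_preimage_smul_of_nullMeasurableSet hu.compl.nullMeasurableSet,
      compl_compl, measure_toMeasurable, hs]
  · refine mem_iInter.2 fun k => ?_
    have := mem_iInter.1 hx (k * g)
    rwa [mem_preimage, mul_smul] at this

/-- An almost everywhere equivariant measurable map which is injective on a conull set is an
isomorphism onto its image measure, and this measure is invariant. -/
theorem MeasurablyIsomorphic.map_of_injOn {Γ X Y : Type*} [Group Γ] [Countable Γ]
    [MulAction Γ X] [MulAction Γ Y] [MeasurableSpace X] [StandardBorelSpace X]
    [MeasurableConstSMul Γ X] [MeasurableSpace Y] [MeasurableSpace.CountablySeparated Y]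
    {μ : Measure X} [SMulInvariantMeasure Γ X μ] {f : X → Y}
    (hf : Measurable f) {s : Set X} (hs : μ sᶜ = 0) (hinj : InjOn f s)
    (hequiv : ∀ x ∈ s, ∀ g : Γ, f (g • x) = g • f x) :
    MeasurablyIsomorphic Γ μ (μ.map f) := by
  obtain ⟨t, hts, ht, ht0, htinv⟩ := exists_measurableSet_invariant_subset_of_conull Γ hs
  have := ht.standardBorel
  -- Lusin–Souslin: an injective measurable map from a standard Borel space to a countably separated
  -- one has measurable images.
  have hemb : MeasurableEmbedding (t.domRestrict f) :=
    (hf.comp measurable_subtype_coe).measurableEmbedding (injOn_iff_injective.1 (hinj.mono hts))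
  have himg := hemb.measurableSet_range
  have he : ∀ x : t, (hemb.equivRange x : Y) = f x := fun x => by
    rw [hemb.equivRange_apply]
    rfl
  refine ⟨t, range (t.domRestrict f), hemb.equivRange, ht, himg, ht0, ?_, htinv, ?_, ?_, ?_⟩
  · rw [Measure.map_apply hf himg.compl]
    exact measure_mono_null (fun x hx hxt => hx ⟨⟨x, hxt⟩, rfl⟩) ht0
  · rintro g _ ⟨⟨x, hx⟩, rfl⟩
    exact ⟨⟨g • x, htinv g x hx⟩, hequiv x (hts hx) g⟩
  · intro g x hgx
    rw [he, he]
    exact hequiv x (hts x.2) g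
  · refine ⟨hemb.equivRange.measurable, ?_⟩
    ext A hA
    rw [Measure.map_apply hemb.equivRange.measurable hA, comap_subtype_coe_apply ht,
      comap_subtype_coe_apply himg, Measure.map_apply hf (himg.subtype_image hA)]
    refine measure_congr ?_
    filter_upwards [measure_eq_zero_iff_ae_notMem.1 ht0] with x hx
    have hxt : x ∈ t := not_not.1 hx
    refine propext ⟨?_, ?_⟩
    · rintro ⟨y, hy, rfl⟩
      exact ⟨hemb.equivRange y, hy, he y⟩
    · rintro ⟨y, hy, hyx⟩
      refine ⟨⟨x, hxt⟩, ?_, rfl⟩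
      rw [mem_preimage]
      convert hy
      exact Subtype.ext ((he _).trans hyx.symm)

/-- The image of an invariant measure under an almost everywhere equivariant map is invariant. -/
theorem MeasureTheory.SMulInvariantMeasure.map_of_ae {Γ X Y : Type*} [Group Γ]
    [MulAction Γ X] [MulAction Γ Y] [MeasurableSpace X]
    [MeasurableConstSMul Γ X] [MeasurableSpace Y] [MeasurableConstSMul Γ Y]
    {μ : Measure X} [SMulInvariantMeasure Γ X μ] {f : X → Y} (hf : Measurable f)
    (hequiv : ∀ g : Γ, ∀ᵐ x ∂μ, f (g • x) = g • f x) : SMulInvariantMeasure Γ Y (μ.map f) where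
  measure_preimage_smul g A hA := by
    rw [Measure.map_apply hf hA, Measure.map_apply hf (measurable_const_smul g hA),
      ← SMulInvariantMeasure.measure_preimage_smul g (hf hA)]
    refine measure_congr ?_
    filter_upwards [hequiv g] with x hx
    exact congrArg A hx.symm

theorem mainTheorem4 {Γ : Type*} [Group Γ] [Countable Γ]
    {X : Type*} [MeasurableSpace X] [StandardBorelSpace X]
    [MulAction Γ X] [MeasurableConstSMul Γ X]
    (μ : Measure X) [IsProbabilityMeasure μ] [ErgodicSMul Γ X μ]
    (hfree : IsEssentiallyFree Γ μ) :
    ∃ ν : Measure (TotalOrd Γ),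
      IsInvariantRandomOrder Γ ν ∧ MeasurablyIsomorphic Γ μ ν := by
  obtain ⟨e, he⟩ := exists_injective_nat Γ
  obtain ⟨φ, hφ⟩ := exists_measurableEmbedding_real X
  let f : X → TotalOrd Γ := TotalOrd.ofOrbit φ ⟨e, he⟩
  have hf : Measurable f := TotalOrd.measurable_ofOrbit hφ.measurable _
  obtain ⟨s, hs, hinj⟩ := TotalOrd.exists_conull_injOn_ofOrbit hfree hφ.measurable hφ.injective
    ⟨e, he⟩
  refine ⟨μ.map f, ⟨Measure.isProbabilityMeasure_map hf.aemeasurable, ?_⟩, ?_⟩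
  · refine .map_of_ae hf fun g => ?_
    filter_upwards [hfree] with x hx
    exact TotalOrd.ofOrbit_smul hφ.injective hx g
  · refine .map_of_injOn (s := s ∩ {x | MulAction.stabilizer Γ x = ⊥}) hf ?_
      (hinj.mono inter_subset_left) fun x hx g => TotalOrd.ofOrbit_smul hφ.injective hx.2 g
    rw [compl_inter]
    exact measure_union_null hs hfree
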